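/- Let $\mathbb K$ be an uncountable algebraically closed field of characteristic zero. An irreducible affine algebraic variety $X$ over $\mathbb K$ is called \emph{toral} if it is isomorphic to a closed subvariety of a torus $(\mathbb K^*)^d$ for some $d\ge 0$. Let $\mathbb K[X]$ be the algebra of regular functions on $X$, let $E(X)=\mathbb K[X]^*/\mathbb K^*$ be the group of invertible regular functions modulo nonzero constants, and let $\mathrm{Aut}(X)$ be the group of regular automorphisms of $X$. Proposition. Let $X$ be a toral variety over $\mathbb K$. Then the following conditions are equivalent: (1) $X$ is a torus, that is, $X$ is isomorphic as a variety to $(\mathbb K^*)^n$ for some $n\ge 0$; (2) $\mathrm{rk}\, E(X)=\dim X$; (3) $\mathrm{Aut}(X)$ acts on $X$ with an orbit that is open in the Zariski topology. -/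

import Mathlib

universe u v w

/-- An affine algebraic variety (not necessarily irreducible) over an algebraically closed field
`K`, as a space with functions: a set of points together with a finitely generated algebra of
`K`-valued functions (the regular functions) such that the points are exactly the `K`-algebra
homomorphisms from the algebra of regular functions to `K`. -/
structure AffineVariety (K : Type u) [Field K] where
  /-- The set of points. -/
  carrier : Type v
  /-- The algebra `K[X]` of regular functions. -/
  regular : Subalgebra K (carrier → K)
  fg : regular.FG
  eval_bijective : Function.Bijective
    (fun x : carrier => (Pi.evalAlgHom K (fun _ : carrier => K) x).comp regular.val)

namespace AffineVariety

variable {K : Type u} [Field K]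

instance : CoeSort (AffineVariety.{u, v} K) (Type v) := ⟨AffineVariety.carrier⟩

/-- The common zeros of a set of functions. -/
def zeros (X : AffineVariety.{u, v} K) (S : Set (X → K)) : Set X :=
  {x | ∀ f ∈ S, f x = 0}

/-- The Zariski topology: the closed sets are the common zeros of sets of regular functions. -/
instance zariskiTopology (X : AffineVariety.{u, v} K) : TopologicalSpace X :=
  TopologicalSpace.ofClosed {Z | ∃ S : Set (X → K), S ⊆ X.regular ∧ Z = X.zeros S}
    ⟨{1}, by simp [X.regular.one_mem], by ext x; simp [zeros]⟩
    (by
      intro A hA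
      refine ⟨{f | f ∈ X.regular ∧ ∃ Z ∈ A, ∀ x ∈ Z, f x = 0}, fun f hf => hf.1, ?_⟩
      ext x
      constructor
      · rintro hx f ⟨-, Z, hZ, hf⟩
        exact hf x (hx Z hZ)
      · intro hx Z hZ
        obtain ⟨S, hS, rfl⟩ := hA hZ
        exact fun f hf => hx f ⟨hS hf, _, hZ, fun y hy => hy f hf⟩)
    (by
      rintro _ ⟨S, hS, rfl⟩ _ ⟨T, hT, rfl⟩
      refine ⟨{h | ∃ f ∈ S, ∃ g ∈ T, h = f * g}, ?_, ?_⟩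
      · rintro _ ⟨f, hf, g, hg, rfl⟩
        exact X.regular.mul_mem (hS hf) (hT hg)
      · ext x
        constructor
        · rintro (hx | hx) _ ⟨f, hf, g, hg, rfl⟩
          · simp [hx f hf]
          · simp [hx g hg]
        · intro hx
          by_contra hcon
          simp only [Set.mem_union, not_or, zeros, Set.mem_ofPred_eq, not_forall] at hcon
          obtain ⟨⟨f, hf, hfx⟩, g, hg, hgx⟩ := hcon
          have := hx (f * g) ⟨f, hf, g, hg, rfl⟩
          exact (mul_ne_zero hfx hgx) this)

theorem isClosed_iff (X : AffineVariety.{u, v} K) (Z : Set X) :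
    IsClosed Z ↔ ∃ S : Set (X → K), S ⊆ X.regular ∧ Z = X.zeros S := by
  rw [← isOpen_compl_iff]
  change (Zᶜ)ᶜ ∈ {Z | ∃ S : Set (X → K), S ⊆ X.regular ∧ Z = X.zeros S} ↔ _
  rw [compl_compl]
  rfl

/-- A regular map (morphism): it pulls regular functions back to regular functions. -/
def IsRegularMap {X : AffineVariety.{u, v} K} {Y : AffineVariety.{u, w} K} (φ : X → Y) : Prop :=
  ∀ g ∈ Y.regular, g ∘ φ ∈ X.regular

/-- `X` and `Y` are isomorphic as varieties. -/
def IsIsomorphic (X : AffineVariety.{u, v} K) (Y : AffineVariety.{u, w} K) : Prop :=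
  ∃ φ : X ≃ Y, IsRegularMap (φ : X → Y) ∧ IsRegularMap (φ.symm : Y → X)

/-- The restriction of functions to a subset. -/
def restrict (X : AffineVariety.{u, v} K) (Z : Set X) : (X → K) →ₐ[K] (Z → K) where
  toFun f z := f z
  map_one' := rfl
  map_mul' _ _ := rfl
  map_zero' := rfl
  map_add' _ _ := rfl
  commutes' _ := rfl

/-- A closed subset as a closed subvariety: its regular functions are the restrictions of the
regular functions of the ambient variety. -/
def closedSubvariety (X : AffineVariety.{u, v} K) (Z : Set X) (hZ : IsClosed Z) :
    AffineVariety.{u, v} K where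
  carrier := Z
  regular := X.regular.map (X.restrict Z)
  fg := X.fg.map _
  eval_bijective := by
    constructor
    · intro x y hxy
      apply Subtype.ext
      apply X.eval_bijective.1
      ext f
      exact DFunLike.congr_fun hxy ⟨X.restrict Z f.1, f.1, f.2, rfl⟩
    · intro φ
      let r : X.regular →ₐ[K] X.regular.map (X.restrict Z) :=
        ((X.restrict Z).comp X.regular.val).codRestrict _ (fun f => ⟨f.1, f.2, rfl⟩)
      obtain ⟨x, hx⟩ := X.eval_bijective.2 (φ.comp r)
      have key : ∀ f : X.regular, f.1 x = φ (r f) := fun f => DFunLike.congr_fun hx f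
      have hxZ : x ∈ Z := by
        obtain ⟨S, hS, hZS⟩ := (X.isClosed_iff Z).1 hZ
        rw [hZS]
        intro f hf
        have h0 : r ⟨f, hS hf⟩ = 0 := by
          apply Subtype.ext
          funext z
          have hz : (z : X) ∈ X.zeros S := hZS ▸ z.2
          exact hz f hf
        have := key ⟨f, hS hf⟩
        rw [h0, map_zero] at this
        exact this
      refine ⟨⟨x, hxZ⟩, ?_⟩
      ext ⟨g, f, hf, rfl⟩
      exact key ⟨f, hf⟩

/-- The torus `(Kˣ)^d`: its regular functions are the Laurent polynomials in the coordinates. -/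
def torus (K : Type u) [Field K] (d : ℕ) : AffineVariety.{u, u} K where
  carrier := Fin d → Kˣ
  regular := Algebra.adjoin K
    (Set.range (fun (i : Fin d) (t : Fin d → Kˣ) => ((t i : Kˣ) : K)) ∪
      Set.range (fun (i : Fin d) (t : Fin d → Kˣ) => (((t i)⁻¹ : Kˣ) : K)))
  fg := Subalgebra.fg_def.2 ⟨_, (Set.finite_range _).union (Set.finite_range _), rfl⟩
  eval_bijective := by
    constructor
    · intro s t hst
      funext i
      apply Units.ext
      exact DFunLike.congr_fun hst ⟨_, Algebra.subset_adjoin (Or.inl ⟨i, rfl⟩)⟩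
    · intro φ
      let x : Fin d → Algebra.adjoin K
          (Set.range (fun (i : Fin d) (t : Fin d → Kˣ) => ((t i : Kˣ) : K)) ∪
            Set.range (fun (i : Fin d) (t : Fin d → Kˣ) => (((t i)⁻¹ : Kˣ) : K))) :=
        fun i => ⟨_, Algebra.subset_adjoin (Or.inl ⟨i, rfl⟩)⟩
      let y : Fin d → Algebra.adjoin K
          (Set.range (fun (i : Fin d) (t : Fin d → Kˣ) => ((t i : Kˣ) : K)) ∪
            Set.range (fun (i : Fin d) (t : Fin d → Kˣ) => (((t i)⁻¹ : Kˣ) : K))) :=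
        fun i => ⟨_, Algebra.subset_adjoin (Or.inr ⟨i, rfl⟩)⟩
      have hxy : ∀ i, x i * y i = 1 := by
        intro i
        apply Subtype.ext
        funext t
        exact (t i).mul_inv
      have hφ : ∀ i, φ (x i) * φ (y i) = 1 := fun i => by rw [← map_mul, hxy, map_one]
      refine ⟨fun i => ⟨φ (x i), φ (y i), hφ i, by rw [mul_comm]; exact hφ i⟩, ?_⟩
      refine AlgHom.adjoin_ext ?_
      rintro _ (⟨i, rfl⟩ | ⟨i, rfl⟩)
      · rfl
      · rfl

/-- An irreducible affine variety is toral if it is isomorphic to a closed subvariety of a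
torus. -/
def IsToral (X : AffineVariety.{u, v} K) : Prop :=
  IrreducibleSpace X ∧
    ∃ (d : ℕ) (Z : Set (torus K d)) (hZ : IsClosed Z),
      X.IsIsomorphic ((torus K d).closedSubvariety Z hZ)

/-- `X` is a torus, as a variety. -/
def IsTorus (X : AffineVariety.{u, v} K) : Prop :=
  ∃ d : ℕ, X.IsIsomorphic (torus K d)

/-- The dimension of `X`: the Krull dimension of `K[X]`. -/
noncomputable def dim (X : AffineVariety.{u, v} K) : WithBot ℕ∞ :=
  ringKrullDim X.regular

/-- The group `E(X) = K[X]ˣ / Kˣ`. -/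
abbrev unitsModConstants (X : AffineVariety.{u, v} K) : Type (max u v) :=
  (X.regular)ˣ ⧸ (Units.map (algebraMap K X.regular : K →* X.regular)).range

instance (X : AffineVariety.{u, v} K) : CommGroup X.unitsModConstants :=
  QuotientGroup.Quotient.commGroup _

/-- The rank of the abelian group `E(X)` (with value `⊤` for an infinite rank). -/
noncomputable def rankE (X : AffineVariety.{u, v} K) : ℕ∞ :=
  Cardinal.toENat (Module.rank ℤ (Additive X.unitsModConstants))

/-- The group `Aut(X)` of regular automorphisms of `X`, acting on the points of `X`. -/
def autGroup (X : AffineVariety.{u, v} K) : Subgroup (Equiv.Perm X) where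
  carrier := {σ | IsRegularMap (σ : X → X) ∧ IsRegularMap (σ.symm : X → X)}
  one_mem' := ⟨fun _ hg => hg, fun _ hg => hg⟩
  mul_mem' := fun ha hb =>
    ⟨fun g hg => hb.1 _ (ha.1 g hg), fun g hg => ha.2 _ (hb.2 g hg)⟩
  inv_mem' := fun h => ⟨h.2, h.1⟩

/-- The action of `Aut(X)` on `X` has a (Zariski) open orbit. -/
def HasOpenAutOrbit (X : AffineVariety.{u, v} K) : Prop :=
  ∃ x : X, IsOpen (MulAction.orbit X.autGroup x)

end AffineVariety

/-! Restricting the coordinates of an ambient torus to `X` gives units whose monomials span `K[X]`.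
Since `K` is algebraically closed, `E(X)` is torsion-free, so the classes of these units generate a
free group of finite rank. Lifting a basis of it gives units `m 1, …, m s` that are independent
modulo constants and whose monomials still span `K[X]`. Thus `laurentHom m` maps the Laurent
polynomials in `s` variables onto `K[X]`, and `X` is a torus once this map is injective.

If the rank of `E(X)` equals the dimension, then `s ≤ dim X`, while a nonzero kernel would force
`dim X < s`.

Suppose instead that some orbit is open. By a weak form of Rosenlicht's theorem `E(X)` is countable,
so automorphisms fall into countably many classes according to where they send the classes of the `m
i`. The orbit is cut into countably many pieces, and over an uncountable field one of them is dense.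
Two automorphisms of one class differ by a map multiplying each monomial by a constant, so these
scalings have a dense orbit. Along it each monomial is, up to a nonzero factor, a character of the
monoid of scalings. Distinct monomials give distinct characters, because the `m i` are independent
modulo constants, and Dedekind's independence of characters makes `laurentHom m` injective.

Conversely, on a torus both the rank and the dimension are the number of coordinates, and
translations act transitively.

For the countability of units, normalize `A` over a polynomial ring `P` and let `O` be the valuation
ring of the degree, that is, of the place at infinity. The integral closure `B` of `O` in the
fraction field of `A` has countably many ideals. Two units with the same ideal data have a ratio
integral over both `P` and `O`, hence over `P ∩ O = K`, so the ratio is constant. -/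

open scoped nonZeroDivisors

/-! ### Countability of units modulo constants -/

section Rosenlicht

/-- A Dedekind domain with countably many nonzero primes has countably many ideals. -/
theorem IsDedekindDomain.countable_ideal (B : Type*) [CommRing B] [IsDedekindDomain B]
    (h : {p : Ideal B | p.IsPrime}.Countable) : Countable (Ideal B) := by
  classical
  have := h.to_subtype
  -- A nonzero ideal is recovered as the product of its multiset of prime factors; `none` is
  -- reserved for the zero ideal.
  let f : Ideal B → Option (Multiset {p : Ideal B | p.IsPrime}) := fun I =>
    if hI : I = ⊥ then none else
      some ((UniqueFactorizationMonoid.normalizedFactors I).attach.map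
        fun p => ⟨p.1, Ideal.isPrime_of_prime
          (UniqueFactorizationMonoid.prime_of_normalized_factor p.1 p.2)⟩)
  have key : ∀ I : Ideal B, I ≠ ⊥ →
      ((f I).map fun s => (s.map Subtype.val).prod) = some I := by
    intro I hI
    simp only [f, hI, dite_false, Option.map_some, Multiset.map_map, Function.comp_def]
    rw [Multiset.attach_map_val, Ideal.prod_normalizedFactors_eq_self hI]
  have hf : Function.Injective f := by
    intro I J hIJ
    by_cases hI : I = ⊥
    · by_cases hJ : J = ⊥
      · rw [hI, hJ]
      · simp [f, hI, hJ] at hIJ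
    · by_cases hJ : J = ⊥
      · simp [f, hI, hJ] at hIJ
      · exact Option.some_injective _ ((key I hI).symm.trans (by rw [hIJ, key J hJ]))
  have : Countable (Multiset {p : Ideal B | p.IsPrime}) :=
    Quotient.countable
  exact hf.countable

open WithZero in
/-- The valuation on a polynomial ring whose value at `p` is the exponential of the total degree
of `p`. -/
noncomputable def MvPolynomial.totalDegreeValuation (σ K : Type*) [Field K] :
    Valuation (MvPolynomial σ K) (WithZero (Multiplicative ℤ)) where
  toFun p := open Classical in if p = 0 then 0 else exp (p.totalDegree : ℤ)
  map_zero' := by simp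
  map_one' := by simp
  map_mul' p q := by
    by_cases hp : p = 0
    · simp [hp]
    by_cases hq : q = 0
    · simp [hq]
    simp [hp, hq, MvPolynomial.totalDegree_mul_of_isDomain hp hq, exp_add]
  map_add_le_max' p q := by
    by_cases hp : p = 0
    · rw [hp, zero_add]; exact le_max_right _ _
    by_cases hq : q = 0
    · rw [hq, add_zero]; exact le_max_left _ _
    by_cases hpq : p + q = 0
    · simp [hpq]
    have := MvPolynomial.totalDegree_add p q
    simp only [hp, hq, hpq, if_false]
    rcases le_max_iff.1 this with h | h
    · exact le_max_of_le_left (exp_le_exp.2 (by exact_mod_cast h))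
    · exact le_max_of_le_right (exp_le_exp.2 (by exact_mod_cast h))

open WithZero in
theorem MvPolynomial.totalDegreeValuation_of_ne_zero {σ K : Type*} [Field K]
    {p : MvPolynomial σ K} (hp : p ≠ 0) :
    totalDegreeValuation σ K p = exp (p.totalDegree : ℤ) :=
  if_neg hp

/-- The valuation ring of a `ℤ`-valued valuation of a field is a principal ideal ring. -/
theorem Valuation.isPrincipalIdealRing_valuationSubring {F : Type*} [Field F]
    (v : Valuation F (WithZero (Multiplicative ℤ))) :
    IsPrincipalIdealRing v.valuationSubring := by
  have hv : v.Integers v.valuationSubring := Valuation.integer.integers v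
  have : MulArchimedean (MonoidHom.mrange v) := inferInstance
  rw [hv.isPrincipalIdealRing_iff_not_denselyOrdered]
  intro hd
  have step : ∀ x : F, v x < 1 → ∃ y : F, v x < v y ∧ v y < 1 := fun x hx => by
    obtain ⟨⟨_, y, rfl⟩, h1, h2⟩ := hd.dense (⟨v x, x, rfl⟩ : Set.range v) ⟨1, 1, map_one v⟩ hx
    exact ⟨y, h1, h2⟩
  -- A dense value group would allow values to climb towards 1 forever, but an integer exponent can
  -- rise only finitely often below 0.
  have no_small : ∀ n : ℕ, ∀ x : F, WithZero.exp (-(n : ℤ)) ≤ v x → ¬ v x < 1 := by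
    intro n
    induction n with
    | zero => intro x hx; simpa using hx
    | succ n ih =>
      intro x hx hx1
      obtain ⟨y, hxy, hy1⟩ := step x hx1
      refine ih y ?_ hy1
      have hy0 : v y ≠ 0 := (zero_le.trans_lt hxy).ne'
      have h := hx.trans_lt hxy
      rw [← WithZero.exp_log hy0, WithZero.exp_lt_exp] at h
      rw [← WithZero.exp_log hy0, WithZero.exp_le_exp]
      push_cast at h
      omega
  obtain ⟨x, hx0, hx1⟩ := step 0 (by simp)
  have hx0' : v x ≠ 0 := (zero_le.trans_lt hx0).ne'
  refine no_small (-(WithZero.log (v x))).toNat x ?_ hx1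
  conv_rhs => rw [← WithZero.exp_log hx0']
  rw [WithZero.exp_le_exp]
  omega

theorem MvPolynomial.nonZeroDivisors_le_primeCompl_supp (σ K : Type*) [Field K] :
    (MvPolynomial σ K)⁰ ≤ (totalDegreeValuation σ K).supp.primeCompl := fun p hp h => by
  have hp0 := nonZeroDivisors.ne_zero hp
  rw [SetLike.mem_coe, Valuation.mem_supp_iff, totalDegreeValuation_of_ne_zero hp0] at h
  exact WithZero.exp_ne_zero h

/-- The valuation on the fraction field of a polynomial ring given by the total degree. -/
noncomputable def MvPolynomial.totalDegreeValuationFrac (σ K : Type*) [Field K] (Q : Type*)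
    [Field Q] [Algebra (MvPolynomial σ K) Q] [IsFractionRing (MvPolynomial σ K) Q] :
    Valuation Q (WithZero (Multiplicative ℤ)) :=
  (totalDegreeValuation σ K).extendToLocalization (nonZeroDivisors_le_primeCompl_supp σ K) Q

/-- A polynomial whose total degree valuation is at most one is constant. -/
theorem MvPolynomial.eq_C_of_totalDegreeValuationFrac_le_one {σ K Q : Type*} [Field K] [Field Q]
    [Algebra (MvPolynomial σ K) Q] [IsFractionRing (MvPolynomial σ K) Q] {p : MvPolynomial σ K}
    (h : totalDegreeValuationFrac σ K Q (algebraMap _ Q p) ≤ 1) : ∃ c : K, p = C c := by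
  by_cases hp : p = 0
  · exact ⟨0, by simp [hp]⟩
  rw [totalDegreeValuationFrac, Valuation.extendToLocalization_apply_map_apply,
    totalDegreeValuation_of_ne_zero hp, ← WithZero.exp_zero, WithZero.exp_le_exp] at h
  exact ⟨_, totalDegree_eq_zero_iff_eq_C.1 (by omega)⟩

/-- In an integral extension by a Dedekind domain of a discrete valuation ring or a field,
there are only countably many ideals. -/
theorem IsDedekindDomain.countable_ideal_of_isIntegral (O B : Type*) [CommRing O]
    [IsLocalRing O] [IsDedekindDomain O] [CommRing B] [IsDedekindDomain B] [Algebra O B]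
    [Algebra.IsIntegral O B] [Module.IsTorsionFree O B] : Countable (Ideal B) := by
  apply IsDedekindDomain.countable_ideal
  -- A nonzero prime of `B` is maximal, so by integrality it lies over the maximal ideal of `O`;
  -- there are finitely many such primes.
  have hfin := IsDedekindDomain.primesOver_finite (IsLocalRing.maximalIdeal O) B
  refine (hfin.countable.union (Set.countable_singleton (⊥ : Ideal B))).mono ?_
  intro p hp
  have hp : p.IsPrime := hp
  by_cases hp0 : p = ⊥
  · exact Or.inr hp0
  · refine Or.inl ⟨hp, ⟨?_⟩⟩
    have := hp.isMaximal hp0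
    have : (p.under O).IsMaximal := Ideal.isMaximal_comap_of_isIntegral_of_isMaximal p
    exact (IsLocalRing.eq_maximalIdeal this).symm

/-- If the common elements of two integrally closed domains with fraction field `Q` are constants
from `K`, then an element of an extension of `Q` integral over both domains is integral over `K`. -/
theorem isIntegral_of_isIntegral_of_isIntegral {K P O Q F : Type*} [Field K] [CommRing P]
    [IsDomain P] [CommRing O] [IsDomain O] [Field Q] [Field F] [IsIntegrallyClosed P]
    [IsIntegrallyClosed O]
    [Algebra P Q] [IsFractionRing P Q] [Algebra O Q] [IsFractionRing O Q] [Algebra Q F]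
    [Algebra P F] [IsScalarTower P Q F] [Algebra O F] [IsScalarTower O Q F]
    [Algebra K F] [Algebra K Q] [IsScalarTower K Q F]
    (h : ∀ (p : P) (o : O), algebraMap P Q p = algebraMap O Q o →
      ∃ c : K, algebraMap P Q p = algebraMap K Q c)
    {u : F} (hP : IsIntegral P u) (hO : IsIntegral O u) : IsIntegral K u := by
  -- The minimal polynomial over `Q` has coefficients both in `P` and in `O`, hence in `K`.
  have e1 := minpoly.isIntegrallyClosed_eq_field_fractions' (R := P) Q hP
  have e2 := minpoly.isIntegrallyClosed_eq_field_fractions' (R := O) Q hO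
  have hl : minpoly Q u ∈ Polynomial.lifts (algebraMap K Q) := by
    rw [Polynomial.lifts_iff_coeff_lifts]
    intro n
    obtain ⟨c, hc⟩ := h ((minpoly P u).coeff n) ((minpoly O u).coeff n) (by
      rw [← Polynomial.coeff_map, ← e1, e2, Polynomial.coeff_map])
    exact ⟨c, by rw [← hc, e1, Polynomial.coeff_map]⟩
  have hm : (minpoly Q u).Monic := by rw [e1]; exact (minpoly.monic hP).map _
  obtain ⟨q, hq, -, hqm⟩ := Polynomial.lifts_and_natDegree_eq_and_monic hl hm
  refine ⟨q, hqm, ?_⟩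
  rw [IsScalarTower.algebraMap_eq K Q F, ← Polynomial.eval₂_map, hq]
  exact minpoly.aeval Q u

/-- Elements of the fraction field with the same numerator and denominator ideals differ by a
factor from the ring. -/
theorem exists_ideal_prod_invariant (B F : Type*) [CommRing B] [IsDomain B] [Field F]
    [Algebra B F] [IsFractionRing B F] :
    ∃ f : F → Ideal B × Ideal B, ∀ u v : F, f u = f v → ∃ b : B, u = algebraMap B F b * v := by
  choose a b hb hab using IsFractionRing.div_surjective (A := B) (K := F)
  refine ⟨fun u => (Ideal.span {a u}, Ideal.span {b u}), fun u v huv => ?_⟩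
  have h1 : Ideal.span {a u} = Ideal.span {a v} := congrArg Prod.fst huv
  have h2 : Ideal.span {b u} = Ideal.span {b v} := congrArg Prod.snd huv
  obtain ⟨c, hc⟩ := Ideal.mem_span_singleton'.1 (h1 ▸ Ideal.mem_span_singleton_self (a u))
  obtain ⟨d, hd⟩ := Ideal.mem_span_singleton'.1 (h2.symm ▸ Ideal.mem_span_singleton_self (b v))
  refine ⟨c * d, ?_⟩
  have hu0 : algebraMap B F (b u) ≠ 0 := IsFractionRing.to_map_ne_zero_of_mem_nonZeroDivisors (hb u)
  have hv0 : algebraMap B F (b v) ≠ 0 := IsFractionRing.to_map_ne_zero_of_mem_nonZeroDivisors (hb v)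
  conv_lhs => rw [← hab u]
  conv_rhs => rw [← hab v]
  rw [map_mul, div_eq_iff hu0, mul_div_assoc', div_mul_eq_mul_div, eq_div_iff hv0, ← hc, ← hd,
    map_mul, map_mul]
  ring

/-- In a domain over an algebraically closed field, the integral elements are the constants. -/
theorem IsIntegral.mem_range_algebraMap_of_isAlgClosed {K A : Type*} [Field K] [IsAlgClosed K]
    [CommRing A] [IsDomain A] [Algebra K A] {a : A} (ha : IsIntegral K a) :
    a ∈ (algebraMap K A).range :=
  minpoly.mem_range_of_degree_eq_one K a
    (IsAlgClosed.degree_eq_one_of_irreducible K (minpoly.irreducible ha))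

/-- A unit that is a constant lies in the range of the units of the field. -/
theorem mem_range_unitsMap_of_mem_range {K A : Type*} [Field K] [CommRing A] [Nontrivial A]
    [Algebra K A] {u : Aˣ} (hu : (u : A) ∈ (algebraMap K A).range) :
    u ∈ (Units.map (algebraMap K A : K →* A)).range := by
  obtain ⟨c, hc⟩ := hu
  have hc0 : c ≠ 0 := fun h => u.ne_zero (by rw [← hc, h, map_zero])
  exact ⟨Units.mk0 c hc0, Units.ext hc⟩

/-- Weak form of Rosenlicht's unit theorem: the units modulo constants of a finitely generated
domain form a countable group. -/
theorem countable_units_quotient_constants (K A : Type*) [Field K] [IsAlgClosed K] [CharZero K]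
    [CommRing A] [IsDomain A] [Algebra K A] [Algebra.FiniteType K A] :
    Countable (Aˣ ⧸ (Units.map (algebraMap K A : K →* A)).range) := by
  obtain ⟨s, g, hginj, hgfin⟩ := exists_finite_inj_algHom_of_fg K A
  let P := MvPolynomial (Fin s) K
  let _ : Algebra P A := g.toAlgebra
  have : IsScalarTower K P A := IsScalarTower.of_algHom g
  have : Module.Finite P A := hgfin
  have : FaithfulSMul P A := (faithfulSMul_iff_algebraMap_injective P A).2 hginj
  let Q := FractionRing P
  let F := FractionRing A
  let _ : Algebra Q F := FractionRing.liftAlgebra P F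
  have : IsScalarTower P Q F := inferInstance
  have : FiniteDimensional Q F := inferInstance
  have : IsScalarTower K P Q := inferInstance
  have : IsScalarTower K P F := inferInstance
  have : IsScalarTower K Q F := inferInstance
  have : CharZero Q := inferInstance
  let w := MvPolynomial.totalDegreeValuationFrac (Fin s) K Q
  let O := w.valuationSubring
  have : IsPrincipalIdealRing O := w.isPrincipalIdealRing_valuationSubring
  let B := integralClosure O F
  have : IsDedekindDomain B := integralClosure.isDedekindDomain O Q F
  have : IsFractionRing B F := integralClosure.isFractionRing_of_finite_extension Q F
  have : Module.IsTorsionFree O B := Module.isTorsionFree_iff_algebraMap_injective.2 fun x y hxy => by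
    have hxy' : algebraMap O F x = algebraMap O F y := congrArg (algebraMap B F) hxy
    rw [IsScalarTower.algebraMap_apply O Q F, IsScalarTower.algebraMap_apply O Q F] at hxy'
    exact Subtype.ext ((algebraMap Q F).injective hxy')
  have : Countable (Ideal B) := IsDedekindDomain.countable_ideal_of_isIntegral O B
  obtain ⟨f, hf⟩ := exists_ideal_prod_invariant B F
  -- Each class is sent to the pair of ideals of `B` attached to a chosen representative.
  refine Function.Injective.countable (f := fun e => f (algebraMap A F (Quotient.out e : Aˣ))) ?_
  intro e₁ e₂ he
  rw [← Quotient.out_eq' e₁, ← Quotient.out_eq' e₂]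
  obtain ⟨b, hb⟩ := hf _ _ he
  set u : Aˣ := Quotient.out e₁
  set v : Aˣ := Quotient.out e₂
  refine QuotientGroup.eq.2 ?_
  rw [← inv_mem_iff, mul_inv_rev, inv_inv, mul_comm]
  have huv : algebraMap A F ((u * v⁻¹ : Aˣ) : A) = b := by
    have : (u : A) = ((u * v⁻¹ : Aˣ) : A) * v := by rw [Units.val_mul, Units.inv_mul_cancel_right]
    rw [this, map_mul] at hb
    exact mul_right_cancel₀ ((map_ne_zero_iff _ (IsFractionRing.injective A F)).2 v.ne_zero) hb
  have hO : IsIntegral O (algebraMap A F ((u * v⁻¹ : Aˣ) : A)) := huv ▸ b.2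
  have hP : IsIntegral P (algebraMap A F ((u * v⁻¹ : Aˣ) : A)) :=
    (Algebra.IsIntegral.isIntegral (R := P) ((u * v⁻¹ : Aˣ) : A)).algebraMap
  -- A polynomial lying in `O` has degree at most 0, so `P` and `O` meet in the constants.
  have hK : IsIntegral K (algebraMap A F ((u * v⁻¹ : Aˣ) : A)) := by
    refine isIntegral_of_isIntegral_of_isIntegral (Q := Q) (fun p o hpo => ?_) hP hO
    obtain ⟨c, hc⟩ := MvPolynomial.eq_C_of_totalDegreeValuationFrac_le_one (p := p) (Q := Q)
      (by rw [hpo]; exact o.2)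
    exact ⟨c, by rw [hc]; rfl⟩
  exact mem_range_unitsMap_of_mem_range ((isIntegral_algebraMap_iff
    (IsFractionRing.injective A F)).1 hK).mem_range_algebraMap_of_isAlgClosed
end Rosenlicht

/-! ### Points avoiding countably many hypersurfaces -/

section GenericPoint

theorem Submonoid.countable_closure {M : Type*} [Monoid M] {s : Set M} (hs : s.Countable) :
    Countable (Submonoid.closure s) := by
  have : Countable s := hs.to_subtype
  have : Countable (FreeMonoid s) := inferInstanceAs (Countable (List s))
  have h : ((Submonoid.closure s : Submonoid M) : Set M).Countable := by
    rw [Submonoid.closure_eq_mrange, MonoidHom.coe_mrange]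
    exact Set.countable_range _
  exact h.to_subtype

theorem rank_le_aleph0_of_adjoin_eq_top {K A : Type*} [Field K] [CommRing A] [Algebra K A]
    {s : Set A} (hs : s.Countable) (h : Algebra.adjoin K s = ⊤) :
    Module.rank K A ≤ Cardinal.aleph0 := by
  have hspan : Submodule.span K (Submonoid.closure s : Set A) = ⊤ := by
    rw [← Algebra.adjoin_eq_span, h, Algebra.top_toSubmodule]
  rw [← rank_top, ← hspan]
  refine (rank_span_le _).trans ?_
  rw [Cardinal.mk_le_aleph0_iff]
  exact Submonoid.countable_closure hs

/-- A field generated as an algebra by a countable set over an uncountable algebraically closed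
field is the field itself. -/
theorem algebraMap_bijective_of_countable_generators {K F : Type*} [Field K] [IsAlgClosed K]
    [Uncountable K] [Field F] [Algebra K F] {s : Set F} (hs : s.Countable)
    (h : Algebra.adjoin K s = ⊤) : Function.Bijective (algebraMap K F) := by
  have hrank := rank_le_aleph0_of_adjoin_eq_top hs h
  have : Algebra.IsAlgebraic K F := by
    by_contra hn
    -- For a transcendental extension the dimension equals the cardinality of `F`, which would make
    -- `F`, and so `K`, countable.
    rw [← Algebra.transcendental_iff_not_isAlgebraic] at hn
    rw [Algebra.Transcendental.rank_eq_cardinalMk, Cardinal.mk_le_aleph0_iff] at hrank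
    exact not_countable ((algebraMap K F).injective.countable)
  exact IsAlgClosed.algebraMap_bijective_of_isIntegral

/-- Over an uncountable algebraically closed field, countably many nonzero elements of a finitely
generated domain are simultaneously nonzero at some point. -/
theorem exists_algHom_forall_ne_zero {K A ι : Type*} [Field K] [IsAlgClosed K] [Uncountable K]
    [CommRing A] [IsDomain A] [Algebra K A] [Algebra.FiniteType K A] [Countable ι] (f : ι → A)
    (hf : ∀ i, f i ≠ 0) : ∃ φ : A →ₐ[K] K, ∀ i, φ (f i) ≠ 0 := by
  let M := Submonoid.closure (Set.range f)
  have hM : M ≤ A⁰ := Submonoid.closure_le.2 (by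
    rintro _ ⟨i, rfl⟩
    exact mem_nonZeroDivisors_of_ne_zero (hf i))
  have hMc : Countable M := Submonoid.countable_closure (Set.countable_range f)
  -- A residue field of the localization inverting all `f i` is still countably generated over `K`,
  -- hence equal to `K`; this gives the point.
  let S := Localization M
  have : Nontrivial S := (IsLocalization.injective S hM).nontrivial
  obtain ⟨m, hm⟩ := Ideal.exists_maximal S
  let _ : Field (S ⧸ m) := Ideal.Quotient.field m
  let π : A →ₐ[K] S ⧸ m := (Ideal.Quotient.mkₐ K m).comp (IsScalarTower.toAlgHom K A S)
  have hπ : ∀ a ∈ M, π a ≠ 0 := fun a ha =>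
    ((IsLocalization.map_units S (⟨a, ha⟩ : M)).map (Ideal.Quotient.mk m)).ne_zero
  obtain ⟨s, hs⟩ := Algebra.FiniteType.out (R := K) (A := A)
  let T : Set (S ⧸ m) := π '' s ∪ Set.range (fun a : M => (π a)⁻¹)
  have hT : T.Countable := (s.countable_toSet.image _).union (Set.countable_range _)
  have hadj : Algebra.adjoin K T = ⊤ := by
    have hA : ∀ a, π a ∈ Algebra.adjoin K T := fun a => by
      have : π a ∈ (Algebra.adjoin K (s : Set A)).map π := ⟨a, hs ▸ Algebra.mem_top, rfl⟩
      rw [AlgHom.map_adjoin] at this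
      exact Algebra.adjoin_mono Set.subset_union_left this
    refine Algebra.eq_top_iff.2 fun x => ?_
    obtain ⟨y, rfl⟩ := Ideal.Quotient.mk_surjective x
    obtain ⟨a, b, rfl⟩ := IsLocalization.exists_mk'_eq M y
    have : Ideal.Quotient.mk m (IsLocalization.mk' S a b) = π a * (π b)⁻¹ := by
      rw [eq_mul_inv_iff_mul_eq₀ (hπ _ b.2)]
      change Ideal.Quotient.mk m _ * Ideal.Quotient.mk m (algebraMap A S b) =
        Ideal.Quotient.mk m (algebraMap A S a)
      rw [← map_mul, IsLocalization.mk'_spec]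
    rw [this]
    exact mul_mem (hA a) (Algebra.subset_adjoin (Or.inr ⟨b, rfl⟩))
  let e : K ≃ₐ[K] S ⧸ m := AlgEquiv.ofBijective (Algebra.ofId K _)
    (algebraMap_bijective_of_countable_generators hT hadj)
  refine ⟨(e.symm : S ⧸ m →ₐ[K] K).comp π, fun i => ?_⟩
  exact (map_ne_zero_iff _ e.symm.injective).2 (hπ _ (Submonoid.subset_closure ⟨i, rfl⟩))

end GenericPoint

/-! ### Laurent polynomial algebras -/

section Laurent

/-- The homomorphism `a ↦ ∏ i, m i ^ a i`. -/
def monomialHom {G : Type*} [CommGroup G] {s : ℕ} (m : Fin s → G) :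
    (Fin s → Multiplicative ℤ) →* G where
  toFun a := ∏ i, m i ^ (a i).toAdd
  map_one' := by simp
  map_mul' a b := by simp [zpow_add, Finset.prod_mul_distrib]

theorem monomialHom_apply {G : Type*} [CommGroup G] {s : ℕ} (m : Fin s → G)
    (a : Fin s → Multiplicative ℤ) : monomialHom m a = ∏ i, m i ^ (a i).toAdd := rfl

theorem map_monomialHom {G H : Type*} [CommGroup G] [CommGroup H] {s : ℕ} (f : G →* H)
    (m : Fin s → G) (a : Fin s → Multiplicative ℤ) :
    f (monomialHom m a) = monomialHom (fun i => f (m i)) a := by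
  simp [monomialHom_apply, map_prod, map_zpow]

@[simp]
theorem monomialHom_mulSingle {G : Type*} [CommGroup G] {s : ℕ} (m : Fin s → G) (i : Fin s) :
    monomialHom m (Pi.mulSingle i (Multiplicative.ofAdd 1)) = m i := by
  rw [monomialHom_apply, Finset.prod_eq_single i]
  · simp
  · intro j _ hj
    simp [Pi.mulSingle_eq_of_ne hj]
  · simp

variable (K : Type*) [Field K]

/-- The algebra of Laurent polynomials in `s` variables. -/
abbrev LaurentAlgebra (s : ℕ) := MonoidAlgebra K (Fin s → Multiplicative ℤ)

variable {K} {A : Type*} [CommRing A] [Algebra K A]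

/-- Substitution of units in Laurent polynomials. -/
noncomputable def laurentHom {s : ℕ} (m : Fin s → Aˣ) : LaurentAlgebra K s →ₐ[K] A :=
  MonoidAlgebra.lift K A _ ((Units.coeHom A).comp (monomialHom m))

@[simp]
theorem laurentHom_of {s : ℕ} (m : Fin s → Aˣ) (a : Fin s → Multiplicative ℤ) :
    laurentHom (K := K) m (MonoidAlgebra.of K _ a) = monomialHom m a := by
  simp [laurentHom]

theorem laurentHom_single {s : ℕ} (m : Fin s → Aˣ) (a : Fin s → Multiplicative ℤ) (c : K) :
    laurentHom m (MonoidAlgebra.single a c) = c • (monomialHom m a : A) := by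
  simp [laurentHom]

theorem laurentHom_injective_iff {s : ℕ} (m : Fin s → Aˣ) :
    Function.Injective (laurentHom (K := K) m) ↔
      LinearIndependent K (fun a => (monomialHom m a : A)) := by
  have : (laurentHom (K := K) m : LaurentAlgebra K s → A) =
      Finsupp.linearCombination K (fun a => (monomialHom m a : A)) ∘ MonoidAlgebra.coeff := by
    funext x
    simp [laurentHom, MonoidAlgebra.lift_apply, Finsupp.linearCombination_apply]
  rw [LinearIndependent, this]
  exact Function.Injective.of_comp_iff' _ MonoidAlgebra.coeffEquiv.bijective

theorem surjective_of_forall_mem_range {s : ℕ} (f : A →ₐ[K] LaurentAlgebra K s)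
    (h : ∀ a, MonoidAlgebra.of K _ a ∈ f.range) : Function.Surjective f := by
  intro x
  change x ∈ f.range
  induction x using MonoidAlgebra.induction_on with
  | of a => exact h a
  | add x y hx hy => exact add_mem hx hy
  | smul c x hx => exact f.range.smul_mem hx c

/-- The units of the algebra of Laurent polynomials are the monomials. -/
theorem LaurentAlgebra.exists_eq_single {s : ℕ} (u : (LaurentAlgebra K s)ˣ) :
    ∃ a c, (u : LaurentAlgebra K s) = MonoidAlgebra.single a c := by
  classical
  set x : LaurentAlgebra K s := u.val
  set y : LaurentAlgebra K s := u⁻¹.val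
  have hxy : x * y = 1 := u.mul_inv
  have hx : x.coeff.support.Nonempty := by
    rw [Finsupp.support_nonempty_iff, ne_eq, MonoidAlgebra.coeff_eq_zero]; exact u.ne_zero
  have hy : y.coeff.support.Nonempty := by
    rw [Finsupp.support_nonempty_iff, ne_eq, MonoidAlgebra.coeff_eq_zero]; exact u⁻¹.ne_zero
  -- A product of exponents attained only once survives in `x * y = 1`, so it must be the identity.
  have hone : ∀ p ∈ x.coeff.support ×ˢ y.coeff.support,
      UniqueMul x.coeff.support y.coeff.support p.1 p.2 → p.1 * p.2 = 1 := by
    intro p hp hu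
    have h := MonoidAlgebra.coeff_mul_mul_of_uniqueMul hu
    rw [Finset.mem_product, Finsupp.mem_support_iff, Finsupp.mem_support_iff] at hp
    by_contra hne
    rw [hxy, MonoidAlgebra.one_def, MonoidAlgebra.coeff_single,
      Finsupp.single_eq_of_ne hne] at h
    exact mul_ne_zero hp.1 hp.2 h.symm
  have hcard : x.coeff.support.card = 1 := by
    by_contra hne
    have h1 : 1 < x.coeff.support.card * y.coeff.support.card := by
      have := hx.card_pos
      have := hy.card_pos
      calc 1 < x.coeff.support.card := by omega
        _ ≤ _ := Nat.le_mul_of_pos_right _ this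
    -- Two different uniquely attained products would both be the identity, contradicting
    -- uniqueness.
    obtain ⟨p, hp, q, hq, hpq, hup, huq⟩ := TwoUniqueProds.uniqueMul_of_one_lt_card h1
    have hq' := Finset.mem_product.1 hq
    have := hup hq'.1 hq'.2 ((hone q hq huq).trans (hone p hp hup).symm)
    exact hpq (Prod.ext this.1.symm this.2.symm)
  obtain ⟨a, ha, hax⟩ := Finsupp.card_support_eq_one.1 hcard
  exact ⟨a, x.coeff a, MonoidAlgebra.coeff_injective hax⟩

variable (K) in
/-- The coordinates of the algebra of Laurent polynomials. -/
noncomputable def LaurentAlgebra.X {s : ℕ} (i : Fin s) : (LaurentAlgebra K s)ˣ :=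
  Units.map (MonoidAlgebra.of K _) (toUnits (Pi.mulSingle i (Multiplicative.ofAdd (1 : ℤ))))

theorem LaurentAlgebra.monomialHom_X {s : ℕ} (a : Fin s → Multiplicative ℤ) :
    (monomialHom (LaurentAlgebra.X K) a : LaurentAlgebra K s) = MonoidAlgebra.of K _ a := by
  have h := map_monomialHom ((Units.map (MonoidAlgebra.of K (Fin s → Multiplicative ℤ))).comp
    toUnits.toMonoidHom) (fun i => Pi.mulSingle i (Multiplicative.ofAdd (1 : ℤ))) a
  have ha : monomialHom (fun i => Pi.mulSingle i (Multiplicative.ofAdd (1 : ℤ))) a = a := by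
    funext j
    rw [monomialHom_apply, Finset.prod_apply, Finset.prod_eq_single j]
    · simp [← ofAdd_zsmul]
    · intro i _ hi
      simp [Pi.mulSingle_eq_of_ne hi.symm]
    · simp
  rw [ha] at h
  exact (congrArg Units.val h).symm

/-- Setting one coordinate equal to 1 kills a nonzerodivisor, so each extra variable raises the
dimension by at least one. -/
theorem LaurentAlgebra.natCast_le_ringKrullDim (s : ℕ) :
    (s : WithBot ℕ∞) ≤ ringKrullDim (LaurentAlgebra K s) := by
  induction s with
  | zero => exact ringKrullDim_nonneg_of_nontrivial
  | succ s ih =>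
    let f : LaurentAlgebra K (s + 1) →ₐ[K] LaurentAlgebra K s :=
      laurentHom (Fin.cons 1 (LaurentAlgebra.X K))
    have hf : Function.Surjective f := surjective_of_forall_mem_range f fun a => by
      refine ⟨MonoidAlgebra.of K _ (Fin.cons 1 a), ?_⟩
      change laurentHom _ _ = _
      rw [laurentHom_of, ← LaurentAlgebra.monomialHom_X, monomialHom_apply, monomialHom_apply]
      simp [Fin.prod_univ_succ]
    have h0 : MonoidAlgebra.of K _ (Pi.mulSingle (0 : Fin (s + 1)) (Multiplicative.ofAdd (1 : ℤ)))
        - 1 ≠ (0 : LaurentAlgebra K (s + 1)) := by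
      rw [sub_ne_zero, ← map_one (MonoidAlgebra.of K _)]
      intro h
      have h' := congrFun (MonoidAlgebra.of_injective h) 0
      rw [Pi.mulSingle_eq_same, Pi.one_apply, ← ofAdd_zero] at h'
      exact one_ne_zero (Multiplicative.ofAdd.injective h')
    have hf0 : f (MonoidAlgebra.of K _ (Pi.mulSingle (0 : Fin (s + 1))
        (Multiplicative.ofAdd (1 : ℤ))) - 1) = 0 := by
      rw [map_sub, map_one f, laurentHom_of, monomialHom_mulSingle, Fin.cons_zero, Units.val_one,
        sub_self]
    have h := ringKrullDim_succ_le_of_surjective (f : LaurentAlgebra K (s + 1) →+* LaurentAlgebra K s)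
      hf (mem_nonZeroDivisors_of_ne_zero h0) hf0
    refine le_trans ?_ h
    push_cast
    gcongr

/-- As for a localization, a prime of `S` is determined by its contraction to `R`, so chains of
primes contract to strict chains. -/
theorem ringKrullDim_le_of_forall_isUnit {R S : Type*} [CommRing R] [CommRing S] (f : R →+* S)
    (h : ∀ x : S, ∃ q, IsUnit (f q) ∧ ∃ p, x * f q = f p) : ringKrullDim S ≤ ringKrullDim R := by
  refine Order.krullDim_le_of_strictMono (PrimeSpectrum.comap f) ?_
  refine Monotone.strictMono_of_injective (fun p q hpq => Ideal.comap_mono hpq) ?_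
  have key : ∀ p q : PrimeSpectrum S, PrimeSpectrum.comap f p = PrimeSpectrum.comap f q →
      ∀ x ∈ p.asIdeal, x ∈ q.asIdeal := by
    intro p q hpq x hx
    obtain ⟨r, hr, t, ht⟩ := h x
    have h1 : t ∈ (PrimeSpectrum.comap f p).asIdeal := by
      change f t ∈ p.asIdeal
      rw [← ht]
      exact p.asIdeal.mul_mem_right _ hx
    rw [hpq] at h1
    have h2 : x * f r ∈ q.asIdeal := ht ▸ h1
    exact (q.asIdeal.mul_unit_mem_iff_mem hr).1 h2
  intro p q hpq
  exact PrimeSpectrum.ext (le_antisymm (key p q hpq) (key q p hpq.symm))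

theorem LaurentAlgebra.ringKrullDim_eq (s : ℕ) :
    ringKrullDim (LaurentAlgebra K s) = s := by
  refine le_antisymm ?_ (natCast_le_ringKrullDim s)
  let f : MvPolynomial (Fin s) K →ₐ[K] LaurentAlgebra K s :=
    MvPolynomial.aeval fun i => (LaurentAlgebra.X K i : LaurentAlgebra K s)
  have hX : ∀ i, f (MvPolynomial.X i) = LaurentAlgebra.X K i := fun i => MvPolynomial.aeval_X _ i
  have hu : ∀ e : Fin s → ℕ, IsUnit (f (∏ i, MvPolynomial.X i ^ e i)) := fun e => by
    rw [map_prod]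
    simp only [map_pow, hX, ← Units.val_pow_eq_pow_val, ← Units.coe_prod]
    exact Units.isUnit _
  have hdim : ringKrullDim (MvPolynomial (Fin s) K) = s := by
    rw [MvPolynomial.ringKrullDim_of_isNoetherianRing]
    simp
  rw [← hdim]
  refine ringKrullDim_le_of_forall_isUnit (f : MvPolynomial (Fin s) K →+* LaurentAlgebra K s) ?_
  intro x
  induction x using MonoidAlgebra.induction_on with
  | of a =>
    -- Denominator and numerator collect the negative and the positive exponents.
    refine ⟨∏ i, MvPolynomial.X i ^ (-(a i).toAdd).toNat, hu _,
      ∏ i, MvPolynomial.X i ^ (a i).toAdd.toNat, ?_⟩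
    change _ * f _ = f _
    rw [← LaurentAlgebra.monomialHom_X, monomialHom_apply]
    simp only [map_prod, map_pow, hX, ← Units.val_pow_eq_pow_val, ← Units.coe_prod]
    rw [← Units.val_mul, ← Finset.prod_mul_distrib]
    congr 1
    refine Finset.prod_congr rfl fun i _ => ?_
    rw [← zpow_natCast, ← zpow_natCast, ← zpow_add]
    congr 1
    omega
  | add x y hx hy =>
    obtain ⟨q, hq, p, hp⟩ := hx
    obtain ⟨q', hq', p', hp'⟩ := hy
    refine ⟨q * q', by rw [map_mul]; exact hq.mul hq', p * q' + p' * q, ?_⟩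
    rw [map_add, map_mul, map_mul, map_mul, ← hp, ← hp']
    ring
  | smul c x hx =>
    obtain ⟨q, hq, p, hp⟩ := hx
    refine ⟨q, hq, c • p, ?_⟩
    rw [smul_mul_assoc, hp]
    exact (map_smul f c p).symm

end Laurent

/-! ### The group of units modulo constants -/

section UnitsModConstants

variable (K : Type*) [Field K] (A : Type*) [CommRing A] [Algebra K A]

/-- The group of units of a `K`-algebra that come from constants. -/
abbrev constantUnits : Subgroup Aˣ := (Units.map (algebraMap K A : K →* A)).range

/-- The group of units of a `K`-algebra modulo constants. -/
abbrev UnitsModConstants : Type _ := Aˣ ⧸ constantUnits K A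

instance : CommGroup (UnitsModConstants K A) := QuotientGroup.Quotient.commGroup _

/-- The class of a unit modulo constants. -/
def unitClass : Aˣ →* UnitsModConstants K A := QuotientGroup.mk' (constantUnits K A)

variable {K A}

theorem unitClass_surjective : Function.Surjective (unitClass K A) :=
  QuotientGroup.mk'_surjective _

theorem unitClass_eq_one_iff {u : Aˣ} : unitClass K A u = 1 ↔ u ∈ constantUnits K A :=
  QuotientGroup.eq_one_iff u

theorem unitClass_eq_iff {u v : Aˣ} :
    unitClass K A u = unitClass K A v ↔ u⁻¹ * v ∈ constantUnits K A :=
  QuotientGroup.eq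

theorem mem_range_of_mem_constantUnits {u : Aˣ} (hu : u ∈ constantUnits K A) :
    (u : A) ∈ (algebraMap K A).range := by
  obtain ⟨c, rfl⟩ := hu
  exact ⟨c, rfl⟩

variable (K A) in
-- A unit with a constant power is integral over `K`, hence constant.
theorem isTorsionFree_units_quotient_constants [IsAlgClosed K] [IsDomain A] :
    Module.IsTorsionFree ℤ (Additive (UnitsModConstants K A)) := by
  have key : ∀ (n : ℕ) (u : Aˣ), n ≠ 0 → u ^ n ∈ constantUnits K A → u ∈ constantUnits K A := by
    intro n u hn hu
    refine mem_range_unitsMap_of_mem_range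
      (IsIntegral.of_pow (Nat.pos_of_ne_zero hn) ?_).mem_range_algebraMap_of_isAlgClosed
    obtain ⟨c, hc⟩ := mem_range_of_mem_constantUnits hu
    rw [← Units.val_pow_eq_pow_val, ← hc]
    exact isIntegral_algebraMap
  rw [Module.isTorsionFree_iff_smul_eq_zero]
  intro n e hne
  by_contra! hcon
  obtain ⟨u, hu⟩ := unitClass_surjective e.toMul
  have h : u ^ n ∈ constantUnits K A := by
    rw [← unitClass_eq_one_iff, map_zpow, hu]
    exact hne
  have h' : u ^ n.natAbs ∈ constantUnits K A := by
    rcases Int.natAbs_eq n with hn | hn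
    · rw [hn, zpow_natCast] at h
      exact h
    · rw [hn, zpow_neg, zpow_natCast, inv_mem_iff] at h
      exact h
  have := key _ u (Int.natAbs_ne_zero.2 hcon.1) h'
  rw [← unitClass_eq_one_iff, hu] at this
  exact hcon.2 this

theorem linearIndependent_ofMul_iff {G : Type*} [CommGroup G] {s : ℕ} (m : Fin s → G) :
    LinearIndependent ℤ (fun i => Additive.ofMul (m i)) ↔ Function.Injective (monomialHom m) := by
  rw [Fintype.linearIndependent_iff, injective_iff_map_eq_one]
  constructor
  · intro h a ha
    funext i
    exact h (fun i => (a i).toAdd) ha i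
  · intro h g hg i
    exact congrFun (h (fun i => Multiplicative.ofAdd (g i)) hg) i

theorem span_range_ofMul_eq_top_iff {G : Type*} [CommGroup G] {s : ℕ} (m : Fin s → G) :
    Submodule.span ℤ (Set.range fun i => Additive.ofMul (m i)) = ⊤ ↔
      Function.Surjective (monomialHom m) := by
  rw [Submodule.eq_top_iff']
  constructor
  · intro h g
    obtain ⟨c, hc⟩ := (Submodule.mem_span_range_iff_exists_fun ℤ).1 (h (Additive.ofMul g))
    exact ⟨fun i => Multiplicative.ofAdd (c i), hc⟩
  · intro h g
    obtain ⟨a, ha⟩ := h g.toMul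
    exact (Submodule.mem_span_range_iff_exists_fun ℤ).2 ⟨fun i => (a i).toAdd, ha⟩

/-- The units of a family modulo constants are monomials in units that are independent modulo
constants. -/
theorem exists_independent_units [IsAlgClosed K] [IsDomain A] {d : ℕ} (t : Fin d → Aˣ) :
    ∃ (s : ℕ) (m : Fin s → Aˣ),
      Function.Injective (monomialHom fun i => unitClass K A (m i)) ∧
      ∀ i, unitClass K A (t i) ∈ (monomialHom fun j => unitClass K A (m j)).range := by
  have := isTorsionFree_units_quotient_constants K A
  let N : Submodule ℤ (Additive (UnitsModConstants K A)) :=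
    Submodule.span ℤ (Set.range fun i => Additive.ofMul (unitClass K A (t i)))
  have : Module.Finite ℤ N := Module.Finite.span_of_finite ℤ (Set.finite_range _)
  -- A finitely generated torsion-free group is free; the `m i` lift a basis.
  obtain ⟨s, b⟩ := Module.basisOfFiniteTypeTorsionFree' (R := ℤ) (M := N)
  choose m hm using fun i => unitClass_surjective (b i : Additive (UnitsModConstants K A)).toMul
  refine ⟨s, m, ?_, fun i => ?_⟩
  · rw [← linearIndependent_ofMul_iff]
    simp only [hm]
    exact b.linearIndependent.map' N.subtype (Submodule.ker_subtype N)
  · let ti : N := ⟨_, Submodule.subset_span (Set.mem_range_self i)⟩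
    refine ⟨fun j => Multiplicative.ofAdd (b.repr ti j), ?_⟩
    have h := congrArg N.subtype (b.sum_repr ti)
    rw [map_sum] at h
    rw [monomialHom_apply]
    simp only [hm]
    exact h

/-- Each monomial in `t` is a constant times a monomial in `m`, so passing from `t` to `m` loses
nothing. -/
theorem laurentHom_surjective_of_unitClass_mem_range {d s : ℕ} {t : Fin d → Aˣ} {m : Fin s → Aˣ}
    (ht : Function.Surjective (laurentHom (K := K) t))
    (h : ∀ i, unitClass K A (t i) ∈ (monomialHom fun j => unitClass K A (m j)).range) :
    Function.Surjective (laurentHom (K := K) m) := by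
  have hmem : ∀ a, (monomialHom t a : A) ∈ (laurentHom (K := K) m).range := by
    intro a
    have ha : unitClass K A (monomialHom t a) ∈
        (monomialHom fun j => unitClass K A (m j)).range := by
      rw [map_monomialHom, monomialHom_apply]
      exact Subgroup.prod_mem _ fun i _ => Subgroup.zpow_mem _ (h i) _
    obtain ⟨b, hb⟩ := ha
    rw [← map_monomialHom, unitClass_eq_iff] at hb
    obtain ⟨c, hc⟩ := mem_range_of_mem_constantUnits hb
    refine ⟨MonoidAlgebra.single b c, ?_⟩
    change laurentHom m _ = _
    rw [laurentHom_single, Algebra.smul_def, hc, ← Units.val_mul, mul_comm,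
      mul_inv_cancel_left]
  intro x
  obtain ⟨y, rfl⟩ := ht x
  change _ ∈ (laurentHom (K := K) m).range
  induction y using MonoidAlgebra.induction_on with
  | of a => rw [laurentHom_of]; exact hmem a
  | add x y hx hy => rw [map_add]; exact add_mem hx hy
  | smul c x hx => rw [map_smul]; exact Subalgebra.smul_mem _ hx c

theorem ringKrullDim_eq_of_laurentHom_bijective {s : ℕ} {m : Fin s → Aˣ}
    (h : Function.Bijective (laurentHom (K := K) m)) : ringKrullDim A = s := by
  rw [← LaurentAlgebra.ringKrullDim_eq (K := K) s]
  exact (ringKrullDim_eq_of_ringEquiv (AlgEquiv.ofBijective _ h).toRingEquiv).symm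

/-- Units of a Laurent algebra are scalar multiples of monomials, so the classes of the `m i` form a
basis. -/
theorem rank_units_quotient_of_laurentHom_bijective {s : ℕ} {m : Fin s → Aˣ}
    (h : Function.Bijective (laurentHom (K := K) m)) :
    Module.rank ℤ (Additive (UnitsModConstants K A)) = s := by
  have : Nontrivial A := h.1.nontrivial
  have hinj : Function.Injective (monomialHom fun i => unitClass K A (m i)) := by
    rw [injective_iff_map_eq_one]
    intro a ha
    rw [← map_monomialHom, unitClass_eq_one_iff] at ha
    obtain ⟨c, hc⟩ := mem_range_of_mem_constantUnits ha
    have : (MonoidAlgebra.of K _ a : LaurentAlgebra K s) = algebraMap K _ c := by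
      apply h.1
      rw [laurentHom_of, AlgHom.commutes, hc]
    by_contra hne
    have h1 := congrArg (fun x => MonoidAlgebra.coeff x a) this
    simp [MonoidAlgebra.coe_algebraMap, Finsupp.single_eq_of_ne hne] at h1
  have hsurj : Function.Surjective (monomialHom fun i => unitClass K A (m i)) := by
    intro e
    obtain ⟨u, rfl⟩ := unitClass_surjective e
    let ε := (AlgEquiv.ofBijective _ h).symm
    obtain ⟨a, c, hac⟩ := LaurentAlgebra.exists_eq_single
      (Units.map ((ε : A →ₐ[K] LaurentAlgebra K s) : A →* LaurentAlgebra K s) u)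
    refine ⟨a, ?_⟩
    rw [← map_monomialHom, unitClass_eq_iff]
    refine mem_range_unitsMap_of_mem_range ⟨c, ?_⟩
    have hu : (u : A) = c • (monomialHom m a : A) := by
      rw [← laurentHom_single, ← hac]
      exact ((AlgEquiv.ofBijective _ h).apply_symm_apply (u : A)).symm
    rw [Units.val_mul, hu, mul_smul_comm, Units.inv_mul, Algebra.algebraMap_eq_smul_one]
  have b := Module.Basis.mk ((linearIndependent_ofMul_iff _).2 hinj)
    ((span_range_ofMul_eq_top_iff _).2 hsurj).ge
  rw [rank_eq_card_basis b, Fintype.card_fin]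

/-- If the rank of the group of units modulo constants equals the dimension, then an algebra
generated by independent units is an algebra of Laurent polynomials. -/
theorem laurentHom_injective_of_rank_eq_ringKrullDim {s : ℕ} {m : Fin s → Aˣ}
    (hsurj : Function.Surjective (laurentHom (K := K) m))
    (hind : Function.Injective (monomialHom fun i => unitClass K A (m i)))
    (hrank : ((Cardinal.toENat (Module.rank ℤ (Additive (UnitsModConstants K A))) : ℕ∞) :
      WithBot ℕ∞) = ringKrullDim A) : Function.Injective (laurentHom (K := K) m) := by
  have hs : (s : WithBot ℕ∞) ≤ ringKrullDim A := by
    rw [← hrank]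
    have h := ((linearIndependent_ofMul_iff _).2 hind).cardinal_lift_le_rank
    rw [Cardinal.mk_fin, Cardinal.lift_natCast, Cardinal.lift_uzero] at h
    have h' := OrderHomClass.mono Cardinal.toENat h
    rw [map_natCast] at h'
    exact_mod_cast h'
  rw [injective_iff_map_eq_zero]
  intro x hx
  by_contra hx0
  -- A nonzero kernel element would lower the dimension of the quotient below `s`.
  have h := ringKrullDim_succ_le_of_surjective (laurentHom (K := K) m : LaurentAlgebra K s →+* A)
    hsurj (mem_nonZeroDivisors_of_ne_zero hx0) hx
  rw [LaurentAlgebra.ringKrullDim_eq] at h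
  have h2 : ((s : WithBot ℕ∞) + 1) ≤ s := le_trans (by gcongr) h
  have h3 : (s + 1 : ℕ) ≤ s := by exact_mod_cast h2
  omega

theorem comp_laurentHom {B : Type*} [CommRing B] [Algebra K B] {s : ℕ} (f : A →ₐ[K] B)
    (m : Fin s → Aˣ) :
    f.comp (laurentHom m) = laurentHom fun i => Units.map (f : A →* B) (m i) := by
  ext a
  change f (laurentHom m (MonoidAlgebra.single a 1)) = laurentHom _ (MonoidAlgebra.single a 1)
  rw [laurentHom_single, laurentHom_single, one_smul, one_smul,
    ← map_monomialHom]
  rfl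

end UnitsModConstants

/-! ### Regular functions on an affine variety -/

namespace AffineVariety

variable {K : Type u} [Field K]

/-- Evaluation of regular functions at a point. -/
def evalAt (X : AffineVariety.{u, v} K) (x : X) : X.regular →ₐ[K] K :=
  (Pi.evalAlgHom K (fun _ : X => K) x).comp X.regular.val

theorem evalAt_injective (X : AffineVariety.{u, v} K) : Function.Injective X.evalAt :=
  X.eval_bijective.1

theorem evalAt_surjective (X : AffineVariety.{u, v} K) : Function.Surjective X.evalAt :=
  X.eval_bijective.2

/-- Evaluation of invertible regular functions at a point. -/
def unitEvalAt (X : AffineVariety.{u, v} K) (x : X) : (X.regular)ˣ →* Kˣ :=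
  Units.map (X.evalAt x : X.regular →* K)

theorem finiteType_regular (X : AffineVariety.{u, v} K) : Algebra.FiniteType K X.regular :=
  Subalgebra.fg_iff_finiteType _ |>.1 X.fg

/-- The pullback of regular functions along a regular map. -/
def IsRegularMap.pullback {X : AffineVariety.{u, v} K} {Y : AffineVariety.{u, w} K} {φ : X → Y}
    (h : IsRegularMap φ) : Y.regular →ₐ[K] X.regular where
  toFun g := ⟨g.1 ∘ φ, h g.1 g.2⟩
  map_one' := rfl
  map_mul' _ _ := rfl
  map_zero' := rfl
  map_add' _ _ := rfl
  commutes' _ := rfl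

theorem IsIsomorphic.exists_pullback_bijective {X : AffineVariety.{u, v} K}
    {Y : AffineVariety.{u, w} K} (h : X.IsIsomorphic Y) :
    ∃ p : Y.regular →ₐ[K] X.regular, Function.Bijective p := by
  obtain ⟨φ, hφ, hφ'⟩ := h
  refine ⟨hφ.pullback, Function.bijective_iff_has_inverse.2 ⟨hφ'.pullback, fun g => ?_, fun f => ?_⟩⟩
  · exact Subtype.ext (funext fun y => congrArg g.1 (φ.apply_symm_apply y))
  · exact Subtype.ext (funext fun x => congrArg f.1 (φ.symm_apply_apply x))

theorem isDomain_regular (X : AffineVariety.{u, v} K) [IrreducibleSpace X] :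
    IsDomain X.regular := by
  have hz : ∀ f ∈ X.regular, IsClosed {x : X | f x = 0} := fun f hf =>
    (X.isClosed_iff _).2 ⟨{f}, by simpa using hf, by simp [zeros]⟩
  have : Nontrivial X.regular := by
    obtain ⟨x⟩ := (inferInstance : Nonempty X)
    exact (X.evalAt x).toRingHom.domain_nontrivial
  have : NoZeroDivisors X.regular := ⟨by
    rintro ⟨f, hf⟩ ⟨g, hg⟩ hfg
    have hfg' : ∀ x, f x * g x = 0 := fun x => congrFun (congrArg Subtype.val hfg) x
    have hcov : (Set.univ : Set X) ⊆ {x | f x = 0} ∪ {x | g x = 0} :=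
      fun x _ => mul_eq_zero.1 (hfg' x)
    rcases isPreirreducible_iff_isClosed_union_isClosed.1
      (PreirreducibleSpace.isPreirreducible_univ (X := X)) _ _ (hz f hf) (hz g hg) hcov with h | h
    · exact Or.inl (Subtype.ext (funext fun x => h (Set.mem_univ x)))
    · exact Or.inr (Subtype.ext (funext fun x => h (Set.mem_univ x)))⟩
  exact NoZeroDivisors.to_isDomain _

/-! ### The torus as a variety -/

section Torus

variable (K) in
/-- The regular functions of the torus. -/
abbrev torusRegular (d : ℕ) : Subalgebra K ((Fin d → Kˣ) → K) := Algebra.adjoin K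
  (Set.range (fun (i : Fin d) (t : Fin d → Kˣ) => ((t i : Kˣ) : K)) ∪
    Set.range (fun (i : Fin d) (t : Fin d → Kˣ) => (((t i)⁻¹ : Kˣ) : K)))

theorem coord_mem_torusRegular (d : ℕ) (i : Fin d) :
    (fun t : Fin d → Kˣ => ((t i : Kˣ) : K)) ∈ torusRegular K d :=
  Algebra.subset_adjoin (Or.inl ⟨i, rfl⟩)

theorem inv_coord_mem_torusRegular (d : ℕ) (i : Fin d) :
    (fun t : Fin d → Kˣ => (((t i)⁻¹ : Kˣ) : K)) ∈ torusRegular K d :=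
  Algebra.subset_adjoin (Or.inr ⟨i, rfl⟩)

variable (K) in
/-- The coordinate functions of the torus. -/
def torusCoord (d : ℕ) (i : Fin d) : ((torus K d).regular)ˣ where
  val := ⟨fun t => ((t i : Kˣ) : K), coord_mem_torusRegular d i⟩
  inv := ⟨fun t => (((t i)⁻¹ : Kˣ) : K), inv_coord_mem_torusRegular d i⟩
  val_inv := Subtype.ext (funext fun t => (t i).mul_inv)
  inv_val := Subtype.ext (funext fun t => (t i).inv_mul)

theorem unitEvalAt_monomialHom_torusCoord {d : ℕ} (t : torus K d) (a : Fin d → Multiplicative ℤ) :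
    (torus K d).unitEvalAt t (monomialHom (torusCoord K d) a) = monomialHom (t : Fin d → Kˣ) a := by
  rw [map_monomialHom]
  congr 2

theorem laurentHom_torusCoord_surjective (d : ℕ) :
    Function.Surjective (laurentHom (K := K) (torusCoord K d)) := by
  have hc : ∀ i, laurentHom (K := K) (torusCoord K d) (MonoidAlgebra.of K _
      (Pi.mulSingle i (Multiplicative.ofAdd 1))) = torusCoord K d i := fun i => by
    rw [laurentHom_of, monomialHom_mulSingle]
  have hc' : ∀ i, laurentHom (K := K) (torusCoord K d) (MonoidAlgebra.of K _
      (Pi.mulSingle i (Multiplicative.ofAdd 1))⁻¹) = ((torusCoord K d i)⁻¹ : _ˣ) := fun i => by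
    rw [laurentHom_of, map_inv, monomialHom_mulSingle]
  have key : ∀ g ∈ torusRegular K d, ∃ p, (laurentHom (K := K) (torusCoord K d) p).1 = g := by
    intro g hg
    induction hg using Algebra.adjoin_induction with
    | mem g hg =>
      rcases hg with ⟨i, rfl⟩ | ⟨i, rfl⟩
      · exact ⟨_, congrArg Subtype.val (hc i)⟩
      · exact ⟨_, congrArg Subtype.val (hc' i)⟩
    | algebraMap c => exact ⟨algebraMap K _ c, by rw [AlgHom.commutes]; rfl⟩
    | add f g _ _ hf hg =>
      obtain ⟨p, rfl⟩ := hf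
      obtain ⟨q, rfl⟩ := hg
      exact ⟨p + q, by rw [map_add]; rfl⟩
    | mul f g _ _ hf hg =>
      obtain ⟨p, rfl⟩ := hf
      obtain ⟨q, rfl⟩ := hg
      exact ⟨p * q, by rw [map_mul]; rfl⟩
  intro g
  obtain ⟨p, hp⟩ := key g.1 g.2
  exact ⟨p, Subtype.ext hp⟩

/-- Monomials are distinct characters of the group of points, so they are linearly independent by
Dedekind. -/
theorem laurentHom_torusCoord_injective [CharZero K] (d : ℕ) :
    Function.Injective (laurentHom (K := K) (torusCoord K d)) := by
  rw [laurentHom_injective_iff]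
  let χ : (Fin d → Multiplicative ℤ) → (Fin d → Kˣ) →* K := fun a =>
    { toFun := fun t => (monomialHom t a : Kˣ)
      map_one' := by simp [monomialHom_apply]
      map_mul' := fun t t' => by
        rw [← Units.val_mul]
        simp [monomialHom_apply, mul_zpow, Finset.prod_mul_distrib] }
  have hχ : Function.Injective χ := by
    intro a b hab
    funext i
    -- In characteristic zero 2 has infinite order, so a point with 2 in place `i` and 1 elsewhere
    -- detects the `i`-th exponent.
    let two : Kˣ := Units.mk0 2 two_ne_zero
    have htwo : ∀ n : ℕ, two ^ n = 1 → n = 0 := by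
      intro n hn
      have h := congrArg Units.val hn
      rw [Units.val_pow_eq_pow_val, Units.val_mk0, Units.val_one] at h
      have h' : (2 : ℕ) ^ n = 1 := by exact_mod_cast h
      simpa using h'
    have hord : ¬ IsOfFinOrder two := by
      rw [isOfFinOrder_iff_pow_eq_one]
      rintro ⟨n, hn, h⟩
      exact hn.ne' (htwo n h)
    have hev : ∀ c : Fin d → Multiplicative ℤ,
        monomialHom (Pi.mulSingle i two : Fin d → Kˣ) c = two ^ (c i).toAdd := by
      intro c
      rw [monomialHom_apply, Finset.prod_eq_single i]
      · simp
      · intro j _ hj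
        simp [Pi.mulSingle_eq_of_ne hj]
      · simp
    have h : monomialHom (Pi.mulSingle i two : Fin d → Kˣ) a = monomialHom (Pi.mulSingle i two) b :=
      Units.ext (DFunLike.congr_fun hab (Pi.mulSingle i two))
    rw [hev, hev] at h
    exact Multiplicative.toAdd.injective (injective_zpow_iff_not_isOfFinOrder.2 hord h)
  have h := (linearIndependent_monoidHom (Fin d → Kˣ) K).comp χ hχ
  let ι : (torus K d).regular →ₗ[K] ((Fin d → Kˣ) → K) := (torusRegular K d).val.toLinearMap
  refine LinearIndependent.of_comp ι ?_
  have hι : (fun f : (Fin d → Kˣ) →* K => (f : (Fin d → Kˣ) → K)) ∘ χ =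
      ι ∘ fun a => (monomialHom (torusCoord K d) a : (torus K d).regular) := by
    funext a t
    exact (congrArg Units.val (unitEvalAt_monomialHom_torusCoord t a)).symm
  rwa [hι] at h

/-- A variety is a torus if its algebra of regular functions is a Laurent polynomial algebra. -/
theorem isTorus_of_laurentHom_bijective (X : AffineVariety.{u, v} K) {s : ℕ}
    {m : Fin s → (X.regular)ˣ} (h : Function.Bijective (laurentHom (K := K) m)) : X.IsTorus := by
  -- The units `m i` serve as the torus coordinates of a point.
  let φ : X → torus K s := fun x i => X.unitEvalAt x (m i)
  have hφ : ∀ x, (X.evalAt x).comp (laurentHom m) = laurentHom (φ x) := fun x =>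
    comp_laurentHom (X.evalAt x) m
  have hbij : Function.Bijective φ := by
    constructor
    · intro x y hxy
      apply X.evalAt_injective
      ext f
      obtain ⟨g, rfl⟩ := h.2 f
      exact DFunLike.congr_fun ((hφ x).trans ((congrArg laurentHom hxy).trans (hφ y).symm)) g
    · intro t
      obtain ⟨x, hx⟩ := X.evalAt_surjective
        ((laurentHom (K := K) (t : Fin s → Kˣ)).comp (AlgEquiv.ofBijective _ h).symm.toAlgHom)
      refine ⟨x, funext fun i => Units.ext ?_⟩
      change X.evalAt x (m i) = _
      have hm : laurentHom (K := K) m (MonoidAlgebra.of K _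
          (Pi.mulSingle i (Multiplicative.ofAdd 1))) = m i := by
        rw [laurentHom_of, monomialHom_mulSingle]
      rw [hx, ← hm]
      change laurentHom _ ((AlgEquiv.ofBijective _ h).symm (AlgEquiv.ofBijective _ h _)) = _
      rw [AlgEquiv.symm_apply_apply]
      exact (laurentHom_of (t : Fin s → Kˣ) _).trans (congrArg Units.val (monomialHom_mulSingle _ i))
  refine ⟨s, Equiv.ofBijective φ hbij, fun g hg => ?_, fun f hf => ?_⟩
  · obtain ⟨p, hp⟩ := laurentHom_torusCoord_surjective s ⟨g, hg⟩
    have : g ∘ φ = (laurentHom m p).1 := by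
      funext x
      have h1 := DFunLike.congr_fun (hφ x) p
      have h2 := DFunLike.congr_fun (comp_laurentHom ((torus K s).evalAt (φ x))
        (torusCoord K s)) p
      rw [AlgHom.comp_apply, hp] at h2
      exact h2.trans h1.symm
    change g ∘ φ ∈ _
    rw [this]
    exact (laurentHom m p).2
  · obtain ⟨p, hp⟩ := h.2 ⟨f, hf⟩
    have : f ∘ (Equiv.ofBijective φ hbij).symm = (laurentHom (torusCoord K s) p).1 := by
      funext t
      obtain ⟨x, rfl⟩ := (Equiv.ofBijective φ hbij).surjective t
      rw [Function.comp_apply, Equiv.symm_apply_apply]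
      have h1 := DFunLike.congr_fun (hφ x) p
      have h2 := DFunLike.congr_fun (comp_laurentHom ((torus K s).evalAt (φ x))
        (torusCoord K s)) p
      rw [AlgHom.comp_apply, hp] at h1
      exact h1.trans h2.symm
    rw [this]
    exact (laurentHom (torusCoord K s) p).2

theorem IsTorus.exists_laurentHom_bijective [CharZero K] {X : AffineVariety.{u, v} K}
    (h : X.IsTorus) :
    ∃ (s : ℕ) (m : Fin s → (X.regular)ˣ), Function.Bijective (laurentHom (K := K) m) := by
  obtain ⟨s, hs⟩ := h
  obtain ⟨p, hp⟩ := hs.exists_pullback_bijective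
  refine ⟨s, fun i => Units.map (p : (torus K s).regular →* X.regular) (torusCoord K s i), ?_⟩
  rw [← comp_laurentHom]
  exact hp.comp ⟨laurentHom_torusCoord_injective s, laurentHom_torusCoord_surjective s⟩

theorem IsTorus.hasOpenAutOrbit {X : AffineVariety.{u, v} K} (h : X.IsTorus) :
    X.HasOpenAutOrbit := by
  obtain ⟨d, φ, hφ, hφ'⟩ := h
  have htrans : ∀ t : Fin d → Kˣ, ∀ g ∈ torusRegular K d,
      (fun z => g (t * z)) ∈ torusRegular K d := by
    intro t g hg
    induction hg using Algebra.adjoin_induction with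
    | mem g hg =>
      rcases hg with ⟨i, rfl⟩ | ⟨i, rfl⟩
      · exact (torusRegular K d).smul_mem (coord_mem_torusRegular d i) (t i : K)
      · have h : (((t i)⁻¹ : Kˣ) : K) • (fun z : Fin d → Kˣ => (((z i)⁻¹ : Kˣ) : K)) ∈
            torusRegular K d :=
          (torusRegular K d).smul_mem (inv_coord_mem_torusRegular d i) _
        convert h using 1
        funext z
        simp [mul_comm]
    | algebraMap c => exact Subalgebra.algebraMap_mem _ c
    | add f g _ _ hf hg => exact add_mem hf hg
    | mul f g _ _ hf hg => exact mul_mem hf hg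
  refine ⟨φ.symm (1 : Fin d → Kˣ), ?_⟩
  have : MulAction.orbit X.autGroup (φ.symm (1 : Fin d → Kˣ)) = Set.univ := by
    rw [Set.eq_univ_iff_forall]
    intro x
    let t : Fin d → Kˣ := φ x
    let τ : (Fin d → Kˣ) ≃ (Fin d → Kˣ) := Equiv.mulLeft t
    let σ : Equiv.Perm X := φ.trans (Equiv.trans τ φ.symm)
    have hσ : σ ∈ X.autGroup := by
      constructor
      · intro g hg
        exact hφ _ (htrans t _ (hφ' _ hg))
      · intro g hg
        exact hφ _ (htrans t⁻¹ _ (hφ' _ hg))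
    refine ⟨⟨σ, hσ⟩, ?_⟩
    change φ.symm (τ (φ (φ.symm (1 : Fin d → Kˣ)))) = x
    exact (congrArg (fun z => φ.symm (τ z)) (φ.apply_symm_apply _)).trans
      ((congrArg φ.symm (mul_one t)).trans (φ.symm_apply_apply x))
  rw [this]
  exact isOpen_univ

end Torus

end AffineVariety

/-! ### Toral varieties and open orbits -/

namespace AffineVariety

variable {K : Type u} [Field K]

theorem IsToral.exists_laurentHom_surjective [IsAlgClosed K] {X : AffineVariety.{u, v} K}
    (h : X.IsToral) : ∃ (s : ℕ) (m : Fin s → (X.regular)ˣ),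
      Function.Injective (monomialHom fun i => unitClass K X.regular (m i)) ∧
      Function.Surjective (laurentHom (K := K) m) := by
  obtain ⟨hirr, d, Z, hZ, hX⟩ := h
  have := X.isDomain_regular
  obtain ⟨p, hp⟩ := hX.exists_pullback_bijective
  let Y := (torus K d).closedSubvariety Z hZ
  let r : (torus K d).regular →ₐ[K] Y.regular :=
    (((torus K d).restrict Z).comp (torus K d).regular.val).codRestrict _
      (fun f => ⟨f.1, f.2, rfl⟩)
  have hr : Function.Surjective r := by
    rintro ⟨_, f, hf, rfl⟩
    exact ⟨⟨f, hf⟩, rfl⟩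
  let q : (torus K d).regular →ₐ[K] X.regular := p.comp r
  have ht : Function.Surjective (laurentHom (K := K) fun i =>
      Units.map (q : (torus K d).regular →* X.regular) (torusCoord K d i)) := by
    rw [← comp_laurentHom]
    exact (hp.2.comp hr).comp (laurentHom_torusCoord_surjective d)
  obtain ⟨s, m, hm, hmem⟩ := exists_independent_units (K := K) fun i =>
      Units.map (q : (torus K d).regular →* X.regular) (torusCoord K d i)
  exact ⟨s, m, hm, laurentHom_surjective_of_unitClass_mem_range ht hmem⟩

/-- If countably many subsets of an irreducible variety have a nonempty open union, then one of them
is dense. -/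
theorem exists_dense_class [IsAlgClosed K] [CharZero K] [Uncountable K]
    {X : AffineVariety.{u, v} K} [IrreducibleSpace X] {ι : Type*} [Countable ι]
    (W : ι → Set X) (hne : (⋃ i, W i).Nonempty) (hopen : IsOpen (⋃ i, W i)) :
    ∃ i, ∀ f ∈ X.regular, (∀ x ∈ W i, f x = 0) → f = 0 := by
  have := X.isDomain_regular
  have := X.finiteType_regular
  obtain ⟨S, hS, hZ⟩ := (X.isClosed_iff _).1 hopen.isClosed_compl
  obtain ⟨y, hy⟩ := hne
  have hy' : y ∉ X.zeros S := fun h => by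
    rw [← hZ] at h
    exact h hy
  obtain ⟨g, hgS, hgy⟩ : ∃ g ∈ S, g y ≠ 0 := by
    simpa [zeros] using hy'
  by_contra! hcon
  choose f hf hfW hf0 using hcon
  -- The extra index `none` carries `g`, whose nonvanishing forces the generic point into the union.
  let F : Option ι → X.regular := fun o => o.elim ⟨g, hS hgS⟩ fun i => ⟨f i, hf i⟩
  have hF : ∀ o, F o ≠ 0 := by
    rintro (_ | i) h
    · exact hgy (congrFun (congrArg Subtype.val h) y)
    · exact hf0 i (congrArg Subtype.val h)
  obtain ⟨φ, hφ⟩ := exists_algHom_forall_ne_zero (K := K) F hF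
  obtain ⟨x, rfl⟩ := X.evalAt_surjective φ
  have hx : x ∈ ⋃ i, W i := by
    by_contra h
    have : x ∈ X.zeros S := hZ ▸ h
    exact hφ none (this g hgS)
  obtain ⟨i, hi⟩ := Set.mem_iUnion.1 hx
  exact hφ (some i) (hfW i x hi)

/-- The permutations of `X` that multiply every monomial in the units `m` by a constant. -/
def scalingSubmonoid (X : AffineVariety.{u, v} K) {s : ℕ} (m : Fin s → (X.regular)ˣ) :
    Submonoid (Equiv.Perm X) where
  carrier := {ρ | ∀ a, ∃ c : Kˣ, ∀ x, X.unitEvalAt (ρ x) (monomialHom m a) =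
    c * X.unitEvalAt x (monomialHom m a)}
  one_mem' _ := ⟨1, fun x => by simp⟩
  mul_mem' {ρ ρ'} h h' a := by
    obtain ⟨c, hc⟩ := h a
    obtain ⟨c', hc'⟩ := h' a
    exact ⟨c * c', fun x => by rw [Equiv.Perm.mul_apply, hc, hc', mul_assoc]⟩

/-- The character by which the scaling permutations act on a monomial. -/
def scalingCharacter (X : AffineVariety.{u, v} K) {s : ℕ} (m : Fin s → (X.regular)ˣ) (y : X)
    (a : Fin s → Multiplicative ℤ) : X.scalingSubmonoid m →* K where
  toFun ρ := (X.unitEvalAt (ρ.1 y) (monomialHom m a) / X.unitEvalAt y (monomialHom m a) : Kˣ)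
  map_one' := by simp
  map_mul' ρ ρ' := by
    obtain ⟨c, hc⟩ := ρ.2 a
    obtain ⟨c', hc'⟩ := ρ'.2 a
    rw [← Units.val_mul]
    congr 1
    change X.unitEvalAt (ρ.1 (ρ'.1 y)) _ / _ = _
    rw [hc, hc', hc]
    simp only [← mul_assoc, mul_div_cancel_right]

theorem scalingCharacter_apply (X : AffineVariety.{u, v} K) {s : ℕ} (m : Fin s → (X.regular)ˣ)
    (y : X) (a : Fin s → Multiplicative ℤ) (ρ : X.scalingSubmonoid m) :
    X.scalingCharacter m y a ρ =
      (X.unitEvalAt (ρ.1 y) (monomialHom m a) / X.unitEvalAt y (monomialHom m a) : Kˣ) := rfl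

theorem map_div_eq_map_div_of_div_eq_div {G H : Type*} [CommGroup G] [CommGroup H] {v w : G →* H}
    {a b : G} (h : v a / w a = v b / w b) : v (a / b) = w (a / b) := by
  rw [map_div, map_div, div_eq_div_iff_div_eq_div.1 h]

/-- If two characters agree, the quotient of their monomials is constant on a dense orbit, hence
constant, contradicting independence modulo constants unless the exponents coincide. -/
theorem scalingCharacter_injective {X : AffineVariety.{u, v} K} {s : ℕ} {m : Fin s → (X.regular)ˣ}
    [Nontrivial X.regular]
    (hm : Function.Injective (monomialHom fun i => unitClass K X.regular (m i))) {y : X}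
    (hy : ∀ f ∈ X.regular, (∀ ρ ∈ X.scalingSubmonoid m, f (ρ y) = 0) → f = 0) :
    Function.Injective (X.scalingCharacter m y) := by
  intro a b hab
  have hconst : ∀ ρ ∈ X.scalingSubmonoid m, X.unitEvalAt (ρ y) (monomialHom m (a / b)) =
      X.unitEvalAt y (monomialHom m (a / b)) := by
    intro ρ hρ
    have h : X.unitEvalAt (ρ y) (monomialHom m a) / X.unitEvalAt y (monomialHom m a) =
        X.unitEvalAt (ρ y) (monomialHom m b) / X.unitEvalAt y (monomialHom m b) := by
      have h := DFunLike.congr_fun hab ⟨ρ, hρ⟩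
      rw [scalingCharacter_apply, scalingCharacter_apply] at h
      exact Units.val_injective h
    rw [map_div]
    exact map_div_eq_map_div_of_div_eq_div h
  have h0 : ∀ c : K, X.unitEvalAt y (monomialHom m (a / b)) = c →
      (monomialHom m (a / b)).1 = algebraMap K X.regular c := by
    intro c hc
    refine Subtype.ext (sub_eq_zero.1 (hy _ (sub_mem (monomialHom m (a / b)).1.2
      (Subtype.prop (algebraMap K X.regular c))) fun ρ hρ => sub_eq_zero.2 ?_))
    exact (congrArg Units.val (hconst ρ hρ)).trans hc
  have hmem : monomialHom m (a / b) ∈ constantUnits K X.regular :=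
    mem_range_unitsMap_of_mem_range ⟨_, (h0 _ rfl).symm⟩
  rw [← unitClass_eq_one_iff, map_monomialHom, map_div, div_eq_one] at hmem
  exact hm hmem

theorem laurentHom_injective_of_dense {X : AffineVariety.{u, v} K} {s : ℕ}
    {m : Fin s → (X.regular)ˣ} [Nontrivial X.regular]
    (hm : Function.Injective (monomialHom fun i => unitClass K X.regular (m i))) {y : X}
    (hy : ∀ f ∈ X.regular, (∀ ρ ∈ X.scalingSubmonoid m, f (ρ y) = 0) → f = 0) :
    Function.Injective (laurentHom (K := K) m) := by
  rw [laurentHom_injective_iff]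
  have h := (linearIndependent_monoidHom (X.scalingSubmonoid m) K).comp _
    (scalingCharacter_injective hm hy)
  have h' := h.units_smul fun a => X.unitEvalAt y (monomialHom m a)
  -- Restricting functions to the orbit of `y` turns each monomial into its value at `y` times its
  -- character.
  let ι : X.regular →ₗ[K] (X.scalingSubmonoid m → K) :=
    { toFun := fun f ρ => f.1 (ρ.1 y)
      map_add' := fun _ _ => rfl
      map_smul' := fun _ _ => rfl }
  refine LinearIndependent.of_comp ι ?_
  have hι : ι ∘ (fun a => (monomialHom m a : X.regular)) =
      (fun a => X.unitEvalAt y (monomialHom m a)) •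
        ((fun f : X.scalingSubmonoid m →* K => (f : X.scalingSubmonoid m → K)) ∘
          X.scalingCharacter m y) := by
    funext a ρ
    change ((X.unitEvalAt (ρ.1 y) (monomialHom m a) : Kˣ) : K) =
      (X.unitEvalAt y (monomialHom m a) : K) * X.scalingCharacter m y a ρ
    rw [scalingCharacter_apply, ← Units.val_mul, mul_div_cancel]
  rw [hι]
  exact h'

/-- Automorphisms that pull back the units `m` to the same classes differ by a scaling. -/
theorem mul_inv_mem_scalingSubmonoid {X : AffineVariety.{u, v} K} {s : ℕ}
    {m : Fin s → (X.regular)ˣ} {σ τ : Equiv.Perm X} (hσ : IsRegularMap σ) (hτ : IsRegularMap τ)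
    (h : ∀ i, unitClass K X.regular (Units.map (hσ.pullback : X.regular →* X.regular) (m i)) =
      unitClass K X.regular (Units.map (hτ.pullback : X.regular →* X.regular) (m i))) :
    σ * τ⁻¹ ∈ X.scalingSubmonoid m := by
  intro a
  have ha : unitClass K X.regular (Units.map (hτ.pullback : X.regular →* X.regular)
      (monomialHom m a)) = unitClass K X.regular (Units.map (hσ.pullback : X.regular →* X.regular)
      (monomialHom m a)) := by
    simp only [map_monomialHom, h]
  rw [unitClass_eq_iff] at ha
  obtain ⟨c, hc⟩ := ha
  refine ⟨c, fun x => ?_⟩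
  have h1 := congrArg (X.unitEvalAt (τ⁻¹ x)) ((eq_inv_mul_iff_mul_eq.1 hc).symm)
  rw [map_mul] at h1
  have e1 : X.unitEvalAt (τ⁻¹ x) (Units.map (hσ.pullback : X.regular →* X.regular)
      (monomialHom m a)) = X.unitEvalAt ((σ * τ⁻¹) x) (monomialHom m a) := rfl
  have e2 : X.unitEvalAt (τ⁻¹ x) (Units.map (hτ.pullback : X.regular →* X.regular)
      (monomialHom m a)) = X.unitEvalAt x (monomialHom m a) := by
    refine Units.ext ?_
    change (monomialHom m a).1.1 (τ (τ⁻¹ x)) = (monomialHom m a).1.1 x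
    exact congrArg _ (τ.apply_symm_apply x)
  have e3 : X.unitEvalAt (τ⁻¹ x) (Units.map (algebraMap K X.regular : K →* X.regular) c) = c :=
    Units.ext rfl
  rw [e1, e2, e3, mul_comm] at h1
  exact h1

theorem HasOpenAutOrbit.laurentHom_injective [IsAlgClosed K] [CharZero K] [Uncountable K]
    {X : AffineVariety.{u, v} K} [IrreducibleSpace X] (h : X.HasOpenAutOrbit) {s : ℕ}
    {m : Fin s → (X.regular)ˣ}
    (hm : Function.Injective (monomialHom fun i => unitClass K X.regular (m i))) :
    Function.Injective (laurentHom (K := K) m) := by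
  have := X.isDomain_regular
  have := X.finiteType_regular
  have : Countable (UnitsModConstants K X.regular) := countable_units_quotient_constants K X.regular
  obtain ⟨x₀, hopen⟩ := h
  -- Automorphisms are sorted by the classes of the pulled-back units; only countably many values
  -- occur.
  let cls : X.autGroup → Fin s → UnitsModConstants K X.regular := fun σ i =>
    unitClass K X.regular (Units.map (σ.2.1.pullback : X.regular →* X.regular) (m i))
  let W : (Fin s → UnitsModConstants K X.regular) → Set X := fun e =>
    {x | ∃ σ : X.autGroup, cls σ = e ∧ σ.1 x₀ = x}
  have hW : MulAction.orbit X.autGroup x₀ = ⋃ e, W e := by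
    ext x
    rw [Set.mem_iUnion]
    constructor
    · rintro ⟨σ, rfl⟩
      exact ⟨cls σ, σ, rfl, rfl⟩
    · rintro ⟨-, σ, -, rfl⟩
      exact ⟨σ, rfl⟩
  rw [hW] at hopen
  obtain ⟨e, he⟩ := exists_dense_class W (hW ▸ MulAction.nonempty_orbit x₀) hopen
  obtain ⟨τ, hτ⟩ : ∃ τ, cls τ = e := by
    by_contra! hcon
    have := he 1 X.regular.one_mem fun x ⟨σ, hσ, _⟩ => (hcon σ hσ).elim
    obtain ⟨x⟩ := (inferInstance : Nonempty X)
    exact one_ne_zero (congrFun this x)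
  -- With `τ` fixed in the dense class, every `σ x₀` of that class is `(σ * τ⁻¹) (τ x₀)`, so it lies
  -- in the scaling orbit of `τ x₀`.
  refine laurentHom_injective_of_dense hm (y := τ.1 x₀) fun f hf hρ => he f hf ?_
  rintro _ ⟨σ, hσ, rfl⟩
  have := hρ _ (mul_inv_mem_scalingSubmonoid (m := m) σ.2.1 τ.2.1
    (fun i => congrFun (hσ.trans hτ.symm) i))
  rw [Equiv.Perm.mul_apply] at this
  exact (congrArg (fun z => f (σ.1 z)) (τ.1.symm_apply_apply x₀)).symm.trans this

end AffineVariety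

/-! ### The equivalences -/

open AffineVariety

theorem mainTheorem4 {K : Type u} [Field K] [IsAlgClosed K] [CharZero K] [Uncountable K]
    (X : AffineVariety.{u, v} K) (hX : X.IsToral) :
    List.TFAE
      [X.IsTorus,
       (X.rankE : WithBot ℕ∞) = X.dim,
       X.HasOpenAutOrbit] := by
  have := hX.1
  have := X.isDomain_regular
  -- This single presentation serves both implications into (1); each only has to prove its
  -- injectivity.
  obtain ⟨s, m, hm, hsurj⟩ := hX.exists_laurentHom_surjective
  tfae_have 1 → 2 := fun h => by
    obtain ⟨d, t, ht⟩ := h.exists_laurentHom_bijective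
    rw [rankE, dim, ringKrullDim_eq_of_laurentHom_bijective ht]
    have h := congrArg Cardinal.toENat (rank_units_quotient_of_laurentHom_bijective ht)
    rw [map_natCast] at h
    exact congrArg _ h
  tfae_have 2 → 1 := fun h =>
    X.isTorus_of_laurentHom_bijective
      ⟨laurentHom_injective_of_rank_eq_ringKrullDim hsurj hm h, hsurj⟩
  tfae_have 1 → 3 := fun h => h.hasOpenAutOrbit
  tfae_have 3 → 1 := fun h =>
    X.isTorus_of_laurentHom_bijective ⟨h.laurentHom_injective hm, hsurj⟩
  tfae_finish
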